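/- Let $\Bbbk$ be an algebraically closed field, $G$ an affine algebraic group over $\Bbbk$ (not necessarily connected) with algebra of polynomial functions $\Bbbk[G]$, and $H\subseteq G$ a closed subgroup. Let $G$ act on $\Bbbk[G]$ by $(x\cdot f)(y)=f(yx)$, and hence also on the total ring of fractions $[\Bbbk[G]]$ of $\Bbbk[G]$ (the ring of rational functions on $G$, which is the field of fractions of $\Bbbk[G]$ if $G$ is connected); write ${}^H\Bbbk[G]$ and ${}^H[\Bbbk[G]]$ for the sets of $H$-fixed elements. Assume that there are a finite-dimensional rational $G$-module $M$ and a vector $m_0\in M$ whose stabilizer $G_{m_0}=\{x\in G: x\cdot m_0=m_0\}$ equals $H$. Then: 1. $H$ is observable in $G$, that is, every finite-dimensional rational $H$-module is isomorphic to an $H$-submodule of (the restriction to $H$ of) a finite-dimensional rational $G$-module; 2. $H=\{z\in G: z\cdot f=f \text{ for all } f\in{}^H\Bbbk[G]\}$; 3. the invariant rational functions are exactly the quotients of invariant polynomials: $${}^H[\Bbbk[G]]=\{a/b : a,b\in{}^H\Bbbk[G],\ b \text{ not a zero divisor in } \Bbbk[G]\}.$$ -/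

import Mathlib

universe u v w

/-- An affine algebraic group over `k` (`k` is algebraically closed in all uses): a group `G` with a
finitely generated algebra `k[G]` of `k`-valued functions on `G`, the polynomial functions, such that
the points of `G` are exactly the `k`-algebra homomorphisms `k[G] → k` (so `G` is an affine variety
with coordinate algebra `k[G]`), and multiplication and inversion are morphisms of varieties. -/
structure AffineAlgGroup (k : Type u) (G : Type v) [Field k] [Group G] where
  /-- the algebra `k[G]` of polynomial functions -/
  coord : Subalgebra k (G → k)
  fg : coord.FG
  /-- distinct points are separated by polynomial functions -/
  separates : ∀ x y : G, (∀ f ∈ coord, f x = f y) → x = y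
  /-- every `k`-algebra homomorphism `k[G] → k` is the evaluation at a point -/
  eval_surj : ∀ φ : coord →ₐ[k] k, ∃ x : G, ∀ f : coord, φ f = (f : G → k) x
  /-- `f (x * y) = ∑ f₁ x * f₂ y` -/
  comul : ∀ f ∈ coord, ∃ (n : ℕ) (f₁ f₂ : Fin n → coord),
    ∀ x y : G, f (x * y) = ∑ i, (f₁ i : G → k) x * (f₂ i : G → k) y
  antipode : ∀ f ∈ coord, (fun x => f x⁻¹) ∈ coord

namespace AffineAlgGroup

variable {k : Type u} {G : Type v} [Field k] [Group G]

/-- `H` is Zariski closed in `G`: it is the set of common zeros of a set of polynomial functions. -/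
def IsClosedSubgroup (𝒢 : AffineAlgGroup k G) (H : Subgroup G) : Prop :=
  ∃ S : Set (G → k), S ⊆ 𝒢.coord ∧ ∀ x : G, x ∈ H ↔ ∀ f ∈ S, f x = 0

/-- Restriction of functions from `G` to `H`. -/
def restrictHom (k : Type u) [Field k] (H : Subgroup G) : (G → k) →ₐ[k] (H → k) where
  toFun f := fun x => f x
  map_one' := rfl
  map_mul' _ _ := rfl
  map_zero' := rfl
  map_add' _ _ := rfl
  commutes' _ := rfl

/-- A closed subgroup `H` as an affine algebraic group: `k[H]` consists of the restrictions to `H` of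
the polynomial functions on `G`. -/
def ofClosed (𝒢 : AffineAlgGroup k G) (H : Subgroup G) (hH : 𝒢.IsClosedSubgroup H) :
    AffineAlgGroup k H where
  coord := 𝒢.coord.map (restrictHom k H)
  fg := 𝒢.fg.map _
  separates x y h := Subtype.ext <| 𝒢.separates _ _ fun f hf =>
    h (restrictHom k H f) (Subalgebra.mem_map.2 ⟨f, hf, rfl⟩)
  eval_surj φ := by
    let r : 𝒢.coord →ₐ[k] (𝒢.coord.map (restrictHom k H)) :=
      ((restrictHom k H).comp 𝒢.coord.val).codRestrict _
        fun f => Subalgebra.mem_map.2 ⟨f, f.2, rfl⟩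
    obtain ⟨x, hx⟩ := 𝒢.eval_surj (φ.comp r)
    obtain ⟨S, hS, hmem⟩ := hH
    have hxH : x ∈ H := by
      rw [hmem]
      intro f hf
      have h0 : r ⟨f, hS hf⟩ = 0 := by
        apply Subtype.ext
        funext y
        exact (hmem y).1 y.2 f hf
      have h1 := hx ⟨f, hS hf⟩
      rw [AlgHom.comp_apply, h0, map_zero] at h1
      exact h1.symm
    refine ⟨⟨x, hxH⟩, ?_⟩
    rintro ⟨g, hg⟩
    obtain ⟨f, hf, rfl⟩ := Subalgebra.mem_map.1 hg
    exact hx ⟨f, hf⟩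
  comul g hg := by
    obtain ⟨f, hf, rfl⟩ := Subalgebra.mem_map.1 hg
    obtain ⟨n, a, b, hab⟩ := 𝒢.comul f hf
    exact ⟨n, fun i => ⟨restrictHom k H (a i), Subalgebra.mem_map.2 ⟨a i, (a i).2, rfl⟩⟩,
      fun i => ⟨restrictHom k H (b i), Subalgebra.mem_map.2 ⟨b i, (b i).2, rfl⟩⟩,
      fun x y => hab x y⟩
  antipode g hg := by
    obtain ⟨f, hf, rfl⟩ := Subalgebra.mem_map.1 hg
    exact Subalgebra.mem_map.2 ⟨_, 𝒢.antipode f hf, rfl⟩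

/-- A `G`-module is rational if every `m` has an element `∑ mᵢ ⊗ fᵢ ∈ M ⊗ k[G]` with
`x · m = ∑ fᵢ x • mᵢ` for all `x`; this element is unique, and it is the value at `m` of the
`k[G]`-comodule structure map of `M`. -/
def IsRational (𝒢 : AffineAlgGroup k G) {M : Type w} [AddCommGroup M] [Module k M]
    (ρ : Representation k G M) : Prop :=
  ∀ m : M, ∃ (n : ℕ) (m' : Fin n → M) (f : Fin n → 𝒢.coord),
    ∀ x : G, ρ x m = ∑ i, (f i : G → k) x • m' i

/-- The closed subgroup `H` is observable in `G`: every finite-dimensional rational `H`-module embeds,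
as an `H`-submodule, in a finite-dimensional rational `G`-module. (Every finite-dimensional space is
isomorphic to some `kⁿ`, so that the universe of `k` is large enough.) -/
def IsObservable (𝒢 : AffineAlgGroup k G) (H : Subgroup G) (hH : 𝒢.IsClosedSubgroup H) : Prop :=
  ∀ (V : Type u) [AddCommGroup V] [Module k V] [FiniteDimensional k V] (σ : Representation k H V),
    (𝒢.ofClosed H hH).IsRational σ →
      ∃ (N : Type u) (_ : AddCommGroup N) (_ : Module k N) (_ : FiniteDimensional k N)
        (ρ : Representation k G N) (ι : V →ₗ[k] N),
        𝒢.IsRational ρ ∧ Function.Injective ι ∧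
          ∀ (x : H) (m : V), ι (σ x m) = ρ (x : G) (ι m)

theorem translate_mem (𝒢 : AffineAlgGroup k G) (x : G) {f : G → k} (hf : f ∈ 𝒢.coord) :
    (fun y => f (y * x)) ∈ 𝒢.coord := by
  obtain ⟨n, a, b, hab⟩ := 𝒢.comul f hf
  have h : (fun y => f (y * x)) = ∑ i, (b i : G → k) x • (a i : G → k) := by
    funext y
    simp [hab, Finset.sum_apply, mul_comm]
  rw [h]
  exact Subalgebra.sum_mem _ fun i _ => Subalgebra.smul_mem _ (a i).2 _

/-- The action of `x ∈ G` on `k[G]`: `(x · f) y = f (y * x)`. -/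
def translate (𝒢 : AffineAlgGroup k G) (x : G) : 𝒢.coord ≃ₐ[k] 𝒢.coord where
  toFun f := ⟨fun y => (f : G → k) (y * x), 𝒢.translate_mem x f.2⟩
  invFun f := ⟨fun y => (f : G → k) (y * x⁻¹), 𝒢.translate_mem x⁻¹ f.2⟩
  left_inv f := Subtype.ext <| funext fun y => by simp
  right_inv f := Subtype.ext <| funext fun y => by simp
  map_mul' _ _ := rfl
  map_add' _ _ := rfl
  commutes' _ := rfl

/-- The invariant polynomials `{f ∈ k[G] : x · f = f for all x ∈ H}`. -/
def invariants (𝒢 : AffineAlgGroup k G) (H : Subgroup G) : Set 𝒢.coord :=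
  {f | ∀ x ∈ H, 𝒢.translate x f = f}

/-- The rational functions on `G`: the total ring of fractions of `k[G]` (the field of fractions when
`G` is connected). -/
abbrev RationalFun (𝒢 : AffineAlgGroup k G) : Type (max u v) := FractionRing 𝒢.coord

/-- The action of `x ∈ G` on rational functions, `x · (a / b) = (x · a) / (x · b)`. -/
noncomputable def translateRational (𝒢 : AffineAlgGroup k G) (x : G) :
    𝒢.RationalFun ≃+* 𝒢.RationalFun :=
  IsFractionRing.ringEquivOfRingEquiv (𝒢.translate x).toRingEquiv

/-- The invariant rational functions. -/
def rationalInvariants (𝒢 : AffineAlgGroup k G) (H : Subgroup G) : Set 𝒢.RationalFun :=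
  {q | ∀ x ∈ H, 𝒢.translateRational x q = q}

/-- The rational functions `a / b` with `a`, `b` invariant polynomials, `b` not a zero divisor of
`k[G]` (that is, `b ≠ 0` when `G` is connected). -/
def quotientsOfInvariants (𝒢 : AffineAlgGroup k G) (H : Subgroup G) : Set 𝒢.RationalFun :=
  {q | ∃ a ∈ 𝒢.invariants H, ∃ b : nonZeroDivisors 𝒢.coord,
    (b : 𝒢.coord) ∈ 𝒢.invariants H ∧ q = IsLocalization.mk' 𝒢.RationalFun a b}

end AffineAlgGroup

/-! The stabilizer hypothesis is used only through `hsep`: the coordinates of `x · m₀` are invariant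
polynomials, so the invariants separate the cosets `xH`. This already gives the second claim.

The core is `exists_invariant_mem_notMem_minimalPrime`. For an `H`-stable ideal `I` and `b ∈ I`
nonzero on a component, generic extension of homomorphisms gives an invariant `d`, nonzero on that
component, such that any point `z` with `d z ≠ 0` has the same invariants as some `y` with `b y ≠
0`. Then `yH = zH`, so a translate of `b` in `I` is nonzero at `z`. Thus `d` vanishes on the zero
set of `I`, and a power of `d` lies in `I`.

Applied to the ideal of denominators of an invariant rational function, this gives the third claim.
Applied to the ideal of a semi-invariant of weight `χ`, it gives a semi-invariant of weight `χ⁻¹`.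
For observability, matrix coefficients of an `H`-module are lifted to `k[G]`; the lift is
equivariant modulo functions vanishing on `H`. A determinant whose other columns form a basis of a
finite-dimensional `H`-stable space of such functions removes the error at the cost of a character,
which a semi-invariant of inverse weight cancels (`exists_equivariant_ne_zero`). Finitely many such
maps embed the module in a power of `k[G]`. -/

/-! ### Generic extension of homomorphisms into an algebraically closed field -/

/-- An embedding of a domain in an algebraically closed field extends to any algebraic domain. -/
theorem exists_ringHom_extension_of_injective {R S k : Type*} [CommRing R] [CommRing S]
    [IsDomain S] [Algebra R S] [FaithfulSMul R S] [Algebra.IsAlgebraic R S] [Field k]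
    [IsAlgClosed k] (φ : R →+* k) (hφ : Function.Injective φ) :
    ∃ ψ : S →+* k, ψ.comp (algebraMap R S) = φ := by
  have : IsDomain R := (FaithfulSMul.algebraMap_injective R S).isDomain _
  let : Algebra R k := φ.toAlgebra
  have : FaithfulSMul R k := (faithfulSMul_iff_algebraMap_injective _ _).2 hφ
  exact ⟨(IsAlgClosed.lift : S →ₐ[R] k).toRingHom, AlgHom.comp_algebraMap _⟩

/-- A homomorphism from `R` to an algebraically closed field extends to any integral extension. -/
theorem exists_ringHom_extension_of_isIntegral {R S k : Type*} [CommRing R] [CommRing S]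
    [Algebra R S] [Algebra.IsIntegral R S] [Field k] [IsAlgClosed k]
    (hinj : Function.Injective (algebraMap R S)) (φ : R →+* k) :
    ∃ ψ : S →+* k, ψ.comp (algebraMap R S) = φ := by
  have hp : (RingHom.ker φ).IsPrime := RingHom.ker_isPrime φ
  obtain ⟨Q, -, hQ, hQc⟩ := Ideal.exists_ideal_over_prime_of_isIntegral (RingHom.ker φ) (⊥ : Ideal S)
    (by
      intro x hx
      have : algebraMap R S x = 0 := by simpa using hx
      rw [(injective_iff_map_eq_zero _).1 hinj x this]
      exact zero_mem _)
  have : Q.LiesOver (RingHom.ker φ) := ⟨hQc.symm⟩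
  have hinjQ : Function.Injective (algebraMap (R ⧸ RingHom.ker φ) (S ⧸ Q)) := by
    rw [injective_iff_map_eq_zero]
    intro x hx
    obtain ⟨x, rfl⟩ := Ideal.Quotient.mk_surjective x
    rw [Ideal.Quotient.eq_zero_iff_mem, ← hQc]
    exact (Ideal.Quotient.eq_zero_iff_mem (I := Q)).1 hx
  have : FaithfulSMul (R ⧸ RingHom.ker φ) (S ⧸ Q) :=
    (faithfulSMul_iff_algebraMap_injective _ _).2 hinjQ
  have hint : Algebra.IsIntegral (R ⧸ RingHom.ker φ) (S ⧸ Q) := inferInstance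
  have halg : Algebra.IsAlgebraic (R ⧸ RingHom.ker φ) (S ⧸ Q) := hint.isAlgebraic
  obtain ⟨ψ, hψ⟩ := exists_ringHom_extension_of_injective (S := S ⧸ Q) (RingHom.kerLift φ)
    (RingHom.kerLift_injective φ)
  refine ⟨ψ.comp (Ideal.Quotient.mk Q), ?_⟩
  ext r
  exact RingHom.congr_fun hψ (Ideal.Quotient.mk _ r)

/-- Generic extension of homomorphisms to an algebraically closed field, along an algebraic
extension of finite type. -/
theorem exists_generic_extension_of_isAlgebraic {R S k : Type*} [CommRing R] [IsDomain R]
    [CommRing S] [IsDomain S] [Algebra R S] [FaithfulSMul R S] [Algebra.IsAlgebraic R S]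
    [Algebra.FiniteType R S] [Field k] [IsAlgClosed k] (b : S) (hb : b ≠ 0) :
    ∃ a : R, a ≠ 0 ∧ ∀ φ : R →+* k, φ a ≠ 0 →
      ∃ ψ : S →+* k, ψ.comp (algebraMap R S) = φ ∧ ψ b ≠ 0 := by
  obtain ⟨s, hs⟩ := (inferInstance : Algebra.FiniteType R S).out
  -- Inverting `c` makes the generators, hence all of `S`, integral. The element `d` is a multiple
  -- of `b` coming from `R`, so `φ d ≠ 0` will force `ψ b ≠ 0`.
  obtain ⟨c, hc, hcs⟩ := Algebra.IsAlgebraic.exists_integral_multiples R s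
  obtain ⟨d, hd, e, he⟩ := (Algebra.IsAlgebraic.isAlgebraic (R := R) b).exists_nonzero_dvd
    (mem_nonZeroDivisors_of_ne_zero hb)
  refine ⟨c * d, mul_ne_zero hc hd, fun φ hφ => ?_⟩
  rw [map_mul] at hφ
  have hφc := left_ne_zero_of_mul hφ
  have hφd := right_ne_zero_of_mul hφ
  let N := Submonoid.powers c
  let R' := Localization N
  let S' := Localization (Algebra.algebraMapSubmonoid S N)
  have hN : Algebra.algebraMapSubmonoid S N ≤ nonZeroDivisors S := by
    rintro _ ⟨_, ⟨n, rfl⟩, rfl⟩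
    exact mem_nonZeroDivisors_of_ne_zero fun h => pow_ne_zero n hc
      ((FaithfulSMul.algebraMap_eq_zero_iff R S).1 h)
  have hu : ∀ y : N, IsUnit (φ y) := by
    rintro ⟨_, n, rfl⟩
    simpa using fun h => absurd h hφc
  have hint : ∀ x : S, IsIntegral R' (algebraMap S S' x) := by
    have : (⊤ : Subalgebra R S) ≤ ((integralClosure R' S').restrictScalars R).comap
        (IsScalarTower.toAlgHom R S S') := by
      rw [← hs, Algebra.adjoin_le_iff]
      intro z hz
      have h1 : IsIntegral R' (algebraMap S S' (c • z)) :=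
        ((hcs z hz).map (IsScalarTower.toAlgHom R S S')).tower_top
      have h2 : algebraMap S S' z =
          (IsLocalization.mk' R' (1 : R) (⟨c, Submonoid.mem_powers c⟩ : N)) •
            algebraMap S S' (c • z) := by
        rw [Algebra.smul_def c z, map_mul, ← IsScalarTower.algebraMap_apply R S S',
          IsScalarTower.algebraMap_apply R R' S', Algebra.smul_def,
          ← mul_assoc, ← map_mul]
        have : IsLocalization.mk' R' (1 : R) (⟨c, Submonoid.mem_powers c⟩ : N) *
            algebraMap R R' c = 1 := by
          simp
        rw [this, map_one, one_mul]
      change IsIntegral R' (algebraMap S S' z)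
      rw [h2]
      exact h1.smul _
    exact fun x => this (Algebra.mem_top (R := R) (x := x))
  have : Algebra.IsIntegral R' S' := by
    refine ⟨fun x => ?_⟩
    obtain ⟨y, ⟨_, t, ht, rfl⟩, rfl⟩ :=
      IsLocalization.exists_mk'_eq (Algebra.algebraMapSubmonoid S N) x
    refine IsIntegral.of_mul_unit (y := algebraMap S S' (algebraMap R S t))
      (r := IsLocalization.mk' R' (1 : R) ⟨t, ht⟩) ?_ ?_
    · rw [← IsScalarTower.algebraMap_apply R S S',
          IsScalarTower.algebraMap_apply R R' S', ← map_mul, IsLocalization.mk'_spec, map_one,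
          map_one]
    · have := IsLocalization.mk'_spec S' y
        (⟨algebraMap R S t, t, ht, rfl⟩ : Algebra.algebraMapSubmonoid S N)
      exact this ▸ hint y
  have hinj : Function.Injective (algebraMap R' S') :=
    IsLocalization.map_injective_of_injective' (S := S) (Sₘ := S') (M := N)
      (f := algebraMap R S) (N := Algebra.algebraMapSubmonoid S N)
      (hf := Submonoid.le_comap_map N)
      (hN := fun h0 => zero_notMem_nonZeroDivisors (hN h0))
      (hf' := FaithfulSMul.algebraMap_injective R S)
  obtain ⟨ψ, hψ⟩ := exists_ringHom_extension_of_isIntegral hinj (IsLocalization.lift hu)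
  have hext : (ψ.comp (algebraMap S S')).comp (algebraMap R S) = φ := by
    rw [RingHom.comp_assoc, ← IsScalarTower.algebraMap_eq R S S',
      IsScalarTower.algebraMap_eq R R' S', ← RingHom.comp_assoc, hψ, IsLocalization.lift_comp]
  refine ⟨_, hext, fun h0 => hφd ?_⟩
  rw [← hext, RingHom.comp_apply, he, map_mul, h0, zero_mul]

/-- Generic extension of homomorphisms to an algebraically closed field, along an extension of
domains of finite type. -/
theorem exists_generic_extension {R S k : Type*} [CommRing R] [IsDomain R]
    [CommRing S] [IsDomain S] [Algebra R S] [FaithfulSMul R S]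
    [Algebra.FiniteType R S] [Field k] [IsAlgClosed k] (b : S) (hb : b ≠ 0) :
    ∃ a : R, a ≠ 0 ∧ ∀ φ : R →+* k, φ a ≠ 0 →
      ∃ ψ : S →+* k, ψ.comp (algebraMap R S) = φ ∧ ψ b ≠ 0 := by
  obtain ⟨ι, x, hx⟩ := exists_isTranscendenceBasis' R S
  let P := MvPolynomial ι R
  let : Algebra P S := (MvPolynomial.aeval x).toAlgebra
  have hinj : Function.Injective (algebraMap P S) := hx.1
  have : FaithfulSMul P S := (faithfulSMul_iff_algebraMap_injective _ _).2 hinj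
  have : IsScalarTower R P S := IsScalarTower.of_algebraMap_eq fun r => by
    change _ = MvPolynomial.aeval x (MvPolynomial.C r)
    simp
  have : Algebra.IsAlgebraic P S := by
    have := hx.isAlgebraic
    refine Algebra.IsAlgebraic.of_ringHom_of_comp_eq (S := Algebra.adjoin R (Set.range x)) (B := S)
      hx.1.aevalEquiv (RingHom.id S) hx.1.aevalEquiv.surjective Function.injective_id ?_
    refine RingHom.ext fun p => ?_
    exact hx.1.algebraMap_aevalEquiv p
  have : Algebra.FiniteType P S := Algebra.FiniteType.of_restrictScalars_finiteType R P S
  obtain ⟨p, hp, hext⟩ := exists_generic_extension_of_isAlgebraic (R := P) (k := k) b hb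
  -- One nonzero coefficient of `p` suffices: if `φ` does not kill it, the image of `p` over the
  -- infinite field `k` has a non-root `y`, at which the variables are specialized.
  obtain ⟨m, hm⟩ := MvPolynomial.ne_zero_iff.1 hp
  refine ⟨p.coeff m, hm, fun φ hφ => ?_⟩
  have hmap : MvPolynomial.map φ p ≠ 0 := MvPolynomial.ne_zero_iff.2 ⟨m, by
    rwa [MvPolynomial.coeff_map]⟩
  have : Infinite k := IsAlgClosed.instInfinite
  obtain ⟨y, hy⟩ : ∃ y : ι → k, MvPolynomial.eval y (MvPolynomial.map φ p) ≠ 0 := by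
    by_contra! h
    exact hmap (MvPolynomial.funext fun y => by rw [h y, map_zero])
  obtain ⟨ψ, hψ, hψb⟩ := hext (MvPolynomial.eval₂Hom φ y) (by
    rwa [MvPolynomial.eval_map] at hy)
  refine ⟨ψ, ?_, hψb⟩
  rw [IsScalarTower.algebraMap_eq R P S, ← RingHom.comp_assoc, hψ]
  ext r
  simp [P, MvPolynomial.algebraMap_eq]

/-- Generic extension of homomorphisms along a homomorphism of finite type into a domain. -/
theorem RingHom.FiniteType.exists_generic_extension {R S k : Type*} [CommRing R]
    [CommRing S] [IsDomain S] [Field k] [IsAlgClosed k] {f : R →+* S} (hf : f.FiniteType)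
    (b : S) (hb : b ≠ 0) :
    ∃ a : R, f a ≠ 0 ∧ ∀ φ : R →+* k, RingHom.ker f ≤ RingHom.ker φ → φ a ≠ 0 →
      ∃ ψ : S →+* k, ψ.comp f = φ ∧ ψ b ≠ 0 := by
  have hp : (RingHom.ker f).IsPrime := RingHom.ker_isPrime f
  let : Algebra (R ⧸ RingHom.ker f) S := (RingHom.kerLift f).toAlgebra
  have : FaithfulSMul (R ⧸ RingHom.ker f) S :=
    (faithfulSMul_iff_algebraMap_injective _ _).2 (RingHom.kerLift_injective f)
  have : Algebra.FiniteType (R ⧸ RingHom.ker f) S := by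
    have : (RingHom.kerLift f).FiniteType :=
      RingHom.FiniteType.of_comp_finiteType (f := Ideal.Quotient.mk (RingHom.ker f)) (by
        convert hf using 1; ext; rfl)
    exact this
  obtain ⟨a, ha, h⟩ := _root_.exists_generic_extension (R := R ⧸ RingHom.ker f) (k := k) b hb
  obtain ⟨a, rfl⟩ := Ideal.Quotient.mk_surjective a
  refine ⟨a, fun h0 => ha (Ideal.Quotient.eq_zero_iff_mem.2 h0), fun φ hφ hφa => ?_⟩
  obtain ⟨ψ, hψ, hψb⟩ := h (Ideal.Quotient.lift _ φ fun x hx => hφ hx) hφa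
  refine ⟨ψ, ?_, hψb⟩
  ext r
  exact RingHom.congr_fun hψ (Ideal.Quotient.mk _ r)

/-! ### Translations, points and irreducible components -/

namespace AffineAlgGroup

variable {k : Type u} {G : Type v} [Field k] [Group G]

theorem leftTranslate_mem (𝒢 : AffineAlgGroup k G) (x : G) {f : G → k} (hf : f ∈ 𝒢.coord) :
    (fun y => f (x * y)) ∈ 𝒢.coord := by
  obtain ⟨n, a, b, hab⟩ := 𝒢.comul f hf
  have h : (fun y => f (x * y)) = ∑ i, (a i : G → k) x • (b i : G → k) := by
    funext y
    simp [hab, Finset.sum_apply]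
  rw [h]
  exact Subalgebra.sum_mem _ fun i _ => Subalgebra.smul_mem _ (b i).2 _

/-- Left translation of polynomial functions: `y ↦ f (x * y)`. -/
def leftTranslate (𝒢 : AffineAlgGroup k G) (x : G) : 𝒢.coord ≃ₐ[k] 𝒢.coord where
  toFun f := ⟨fun y => (f : G → k) (x * y), 𝒢.leftTranslate_mem x f.2⟩
  invFun f := ⟨fun y => (f : G → k) (x⁻¹ * y), 𝒢.leftTranslate_mem x⁻¹ f.2⟩
  left_inv f := Subtype.ext <| funext fun y => by simp
  right_inv f := Subtype.ext <| funext fun y => by simp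
  map_mul' _ _ := rfl
  map_add' _ _ := rfl
  commutes' _ := rfl

theorem leftTranslate_apply (𝒢 : AffineAlgGroup k G) (x : G) (f : 𝒢.coord) (y : G) :
    (𝒢.leftTranslate x f : G → k) y = (f : G → k) (x * y) := rfl

theorem translate_apply (𝒢 : AffineAlgGroup k G) (x : G) (f : 𝒢.coord) (y : G) :
    (𝒢.translate x f : G → k) y = (f : G → k) (y * x) := rfl

/-- Evaluation of polynomial functions at a point. -/
def evalHom (𝒢 : AffineAlgGroup k G) (x : G) : 𝒢.coord →ₐ[k] k :=
  (Pi.evalAlgHom k (fun _ : G => k) x).comp 𝒢.coord.val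

theorem evalHom_apply (𝒢 : AffineAlgGroup k G) (x : G) (f : 𝒢.coord) :
    𝒢.evalHom x f = (f : G → k) x := rfl

theorem mem_invariants_iff (𝒢 : AffineAlgGroup k G) {H : Subgroup G} {f : 𝒢.coord} :
    f ∈ 𝒢.invariants H ↔ ∀ x ∈ H, ∀ y, (f : G → k) (y * x) = (f : G → k) y :=
  forall₂_congr fun x _ => by
    rw [Subtype.ext_iff, funext_iff]
    rfl

/-- The invariant polynomials, as a subalgebra of `k[G]`. -/
def invariantSubalgebra (𝒢 : AffineAlgGroup k G) (H : Subgroup G) : Subalgebra k 𝒢.coord where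
  carrier := 𝒢.invariants H
  mul_mem' ha hb x hx := by rw [map_mul, ha x hx, hb x hx]
  add_mem' ha hb x hx := by rw [map_add, ha x hx, hb x hx]
  algebraMap_mem' r x _ := AlgEquiv.commutes _ r

theorem leftTranslate_mem_invariants (𝒢 : AffineAlgGroup k G) {H : Subgroup G} (g : G)
    {f : 𝒢.coord} (hf : f ∈ 𝒢.invariants H) : 𝒢.leftTranslate g f ∈ 𝒢.invariants H := by
  rw [mem_invariants_iff] at hf ⊢
  intro x hx y
  rw [leftTranslate_apply, leftTranslate_apply, ← mul_assoc, hf x hx]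

theorem finiteType_coord (𝒢 : AffineAlgGroup k G) : Algebra.FiniteType k 𝒢.coord :=
  (Subalgebra.fg_iff_finiteType _).1 𝒢.fg

theorem isNoetherianRing_coord (𝒢 : AffineAlgGroup k G) : IsNoetherianRing 𝒢.coord :=
  have := 𝒢.finiteType_coord
  Algebra.FiniteType.isNoetherianRing k 𝒢.coord

theorem isReduced_coord (𝒢 : AffineAlgGroup k G) : IsReduced 𝒢.coord :=
  isReduced_of_injective 𝒢.coord.val Subtype.val_injective

theorem comap_leftTranslate_mem_minimalPrimes (𝒢 : AffineAlgGroup k G)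
    {P : Ideal 𝒢.coord} (hP : P ∈ minimalPrimes 𝒢.coord)
    (g : G) : P.comap (𝒢.leftTranslate g) ∈ minimalPrimes 𝒢.coord := by
  rw [minimalPrimes_eq_minimals] at hP ⊢
  have := hP.1
  refine ⟨Ideal.comap_isPrime _ _, fun Q hQ hle f hf => ?_⟩
  have h1 : Q.comap (𝒢.leftTranslate g).symm ≤ P := fun f hf => by
    have := hle (show (𝒢.leftTranslate g).symm f ∈ Q from hf)
    simpa [Ideal.mem_comap] using this
  have hQ' : (Q.comap (𝒢.leftTranslate g).symm).IsPrime := Ideal.comap_isPrime _ _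
  have h2 := hP.2 hQ' h1 (show 𝒢.leftTranslate g f ∈ P from hf)
  simpa [Ideal.mem_comap] using h2

section Points

variable [IsAlgClosed k] (𝒢 : AffineAlgGroup k G)

/-- A function outside a prime ideal is nonzero at some zero of the ideal. -/
theorem exists_point_of_notMem_prime (P : Ideal 𝒢.coord) [P.IsPrime] {b : 𝒢.coord} (hb : b ∉ P) :
    ∃ x : G, (∀ f ∈ P, (f : G → k) x = 0) ∧ (b : G → k) x ≠ 0 := by
  have := 𝒢.finiteType_coord
  have : Nontrivial (𝒢.coord ⧸ P) := Ideal.Quotient.nontrivial_iff.2 (Ideal.IsPrime.ne_top ‹_›)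
  have hft : RingHom.FiniteType (A := k) (B := 𝒢.coord ⧸ P) (algebraMap k (𝒢.coord ⧸ P)) :=
    RingHom.finiteType_algebraMap.2 inferInstance
  obtain ⟨a, ha, h⟩ := hft.exists_generic_extension (k := k) (Ideal.Quotient.mk P b)
    (fun h0 => hb (Ideal.Quotient.eq_zero_iff_mem.1 h0))
  obtain ⟨ψ, hψ, hψb⟩ := h (RingHom.id k)
    (((RingHom.injective_iff_ker_eq_bot _).1 (RingHom.injective _)).trans_le bot_le)
    (fun h0 => ha (by rw [show a = 0 from h0, map_zero]))
  obtain ⟨x, hx⟩ := 𝒢.eval_surj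
    { ψ.comp (Ideal.Quotient.mk P) with commutes' := fun r => RingHom.congr_fun hψ r }
  have hx' : ∀ f : 𝒢.coord, ψ (Ideal.Quotient.mk P f) = (f : G → k) x := hx
  refine ⟨x, fun f hf => ?_, ?_⟩
  · rw [← hx', Ideal.Quotient.eq_zero_iff_mem.2 hf, map_zero]
  · rwa [← hx']

/-- Nullstellensatz for `k[G]`. -/
theorem mem_radical_of_vanishing (I : Ideal 𝒢.coord) (f : 𝒢.coord)
    (h : ∀ x : G, (∀ g ∈ I, (g : G → k) x = 0) → (f : G → k) x = 0) : f ∈ I.radical := by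
  rw [Ideal.radical_eq_sInf, Ideal.mem_sInf]
  rintro P ⟨hIP, hP⟩
  by_contra hf
  obtain ⟨x, hx, hfx⟩ := 𝒢.exists_point_of_notMem_prime P hf
  exact hfx (h x fun g hg => hx g (hIP hg))

/-- Left translations permute the irreducible components of `G` transitively. -/
theorem exists_comap_leftTranslate_eq {P P' : Ideal 𝒢.coord} (hP : P ∈ minimalPrimes 𝒢.coord)
    (hP' : P' ∈ minimalPrimes 𝒢.coord) : ∃ g : G, P.comap (𝒢.leftTranslate g) = P' := by
  have := 𝒢.isNoetherianRing_coord
  have hfin : (Set.range fun g : G => P.comap (𝒢.leftTranslate g)).Finite :=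
    (minimalPrimes.finite_of_isNoetherianRing 𝒢.coord).subset (by
      rintro _ ⟨g, rfl⟩
      exact 𝒢.comap_leftTranslate_mem_minimalPrimes hP g)
  have hPp : P.IsPrime := Ideal.IsMinimalPrime.isPrime hP
  have hPp' : P'.IsPrime := Ideal.IsMinimalPrime.isPrime hP'
  obtain ⟨x, hx, -⟩ := 𝒢.exists_point_of_notMem_prime P (b := 1)
    (fun h => hPp.ne_top ((Ideal.eq_top_iff_one _).2 h))
  -- A function whose left translates all vanish at one point is zero. So the finitely many
  -- translates of `P` intersect in zero, and the prime `P'` contains one of them.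
  have hle : hfin.toFinset.inf id ≤ P' := by
    intro f hf
    have hf' : ∀ g : G, 𝒢.leftTranslate g f ∈ P := fun g => by
      have : hfin.toFinset.inf id ≤ P.comap (𝒢.leftTranslate g) :=
        Finset.inf_le (f := id) (hfin.mem_toFinset.2 ⟨g, rfl⟩)
      exact this hf
    have : f = 0 := by
      ext y
      have := hx _ (hf' (y * x⁻¹))
      rwa [leftTranslate_apply, inv_mul_cancel_right] at this
    rw [this]
    exact zero_mem _
  obtain ⟨Q, hQ, hQP⟩ := (Ideal.IsPrime.inf_le' hPp').1 hle
  obtain ⟨g, rfl⟩ := hfin.mem_toFinset.1 hQ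
  refine ⟨g, le_antisymm hQP ?_⟩
  rw [minimalPrimes_eq_minimals] at hP'
  exact hP'.2 (Ideal.comap_isPrime _ _) hQP

/-- The contractions of minimal primes to the ring of invariants are pairwise equal or
incomparable. -/
theorem invariants_contraction_symm (H : Subgroup G) {P P' : Ideal 𝒢.coord}
    (hP : P ∈ minimalPrimes 𝒢.coord) (hP' : P' ∈ minimalPrimes 𝒢.coord)
    (hle : ∀ f ∈ 𝒢.invariants H, f ∈ P → f ∈ P') : ∀ f ∈ 𝒢.invariants H, f ∈ P' → f ∈ P := by
  have := 𝒢.isNoetherianRing_coord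
  -- Left translations preserve the invariants, so the inclusion can be carried to a translate of
  -- `P` with maximal contraction, where it is an equality.
  obtain ⟨Q, hQ⟩ := (minimalPrimes.finite_of_isNoetherianRing 𝒢.coord).exists_maximalFor
    (fun P : Ideal 𝒢.coord => (P : Set 𝒢.coord) ∩ 𝒢.invariants H) _ ⟨P, hP⟩
  obtain ⟨g, rfl⟩ := 𝒢.exists_comap_leftTranslate_eq hP hQ.1
  have hQ' := hQ.2 (𝒢.comap_leftTranslate_mem_minimalPrimes hP' g) (by
    rintro f ⟨hf, hfH⟩
    exact ⟨hle _ (𝒢.leftTranslate_mem_invariants g hfH) hf, hfH⟩)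
  intro f hfH hf
  have hgf : 𝒢.leftTranslate g (𝒢.leftTranslate g⁻¹ f) = f := by
    ext y
    simp [leftTranslate_apply]
  have := (hQ' ⟨(show 𝒢.leftTranslate g (𝒢.leftTranslate g⁻¹ f) ∈ P' by rwa [hgf]),
    𝒢.leftTranslate_mem_invariants g⁻¹ hfH⟩).1
  have h2 : 𝒢.leftTranslate g (𝒢.leftTranslate g⁻¹ f) ∈ P := this
  rwa [hgf] at h2

/-! ### Invariant elements of stable ideals -/

/-- If the invariant polynomials separate the cosets `xH`, then an `H`-stable ideal that does not
vanish on an irreducible component of `G` has an invariant element that does not vanish there. -/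
theorem exists_invariant_mem_notMem_minimalPrime (H : Subgroup G)
    (hsep : ∀ u z : G, (∀ f ∈ 𝒢.invariants H, (f : G → k) u = (f : G → k) z) → u⁻¹ * z ∈ H)
    (I : Ideal 𝒢.coord) (hI : ∀ h ∈ H, ∀ f ∈ I, 𝒢.translate h f ∈ I)
    {P : Ideal 𝒢.coord} (hP : P ∈ minimalPrimes 𝒢.coord) (hIP : ¬ I ≤ P) :
    ∃ f ∈ I, f ∈ 𝒢.invariants H ∧ f ∉ P := by
  classical
  have := 𝒢.isNoetherianRing_coord
  have := 𝒢.finiteType_coord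
  have hPp : P.IsPrime := Ideal.IsMinimalPrime.isPrime hP
  obtain ⟨b, hbI, hbP⟩ := SetLike.not_le_iff_exists.1 hIP
  let A := 𝒢.invariantSubalgebra H
  let π : A →+* 𝒢.coord ⧸ P := (Ideal.Quotient.mk P).comp A.val.toRingHom
  -- The invariants need not be finitely generated; the quotient is of finite type over them because
  -- it already is over `k`.
  have hπ : π.FiniteType :=
    RingHom.FiniteType.of_comp_finiteType (A := k) (B := A) (C := 𝒢.coord ⧸ P)
      (f := algebraMap k A) (RingHom.finiteType_algebraMap (A := k) (B := 𝒢.coord ⧸ P) |>.2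
        inferInstance)
  obtain ⟨a, ha, hext⟩ := hπ.exists_generic_extension (k := k) (Ideal.Quotient.mk P b)
    (fun h0 => hbP (Ideal.Quotient.eq_zero_iff_mem.1 h0))
  have haP : (a : 𝒢.coord) ∉ P := fun h => ha (Ideal.Quotient.eq_zero_iff_mem.2 h)
  have hfin := minimalPrimes.finite_of_isNoetherianRing 𝒢.coord
  -- The factor `c P'` excludes the points of a component `P'` at which evaluation of invariants
  -- might not kill the contraction of `P`.
  have hc : ∀ P' ∈ minimalPrimes 𝒢.coord, ∃ c ∈ 𝒢.invariants H, c ∉ P ∧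
      (c ∉ P' → ∀ f ∈ 𝒢.invariants H, f ∈ P → f ∈ P') := by
    intro P' hP'
    by_cases h : ∀ f ∈ 𝒢.invariants H, f ∈ P → f ∈ P'
    · exact ⟨1, A.one_mem, fun h1 => hPp.ne_top ((Ideal.eq_top_iff_one _).2 h1), fun _ => h⟩
    · have h' : ¬ ∀ f ∈ 𝒢.invariants H, f ∈ P' → f ∈ P :=
        fun h' => h (𝒢.invariants_contraction_symm H hP' hP h')
      push Not at h'
      obtain ⟨c, hcH, hcP', hcP⟩ := h'
      exact ⟨c, hcH, hcP, fun h => absurd hcP' h⟩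
  choose! c hcH hcP hcP' using hc
  let d : 𝒢.coord := a * ∏ P' ∈ hfin.toFinset, c P'
  have hdA : d ∈ A := A.mul_mem a.2 (A.prod_mem fun P' hP' => hcH P' (hfin.mem_toFinset.1 hP'))
  have hdP : d ∉ P := by
    intro h
    rcases hPp.mem_or_mem h with h | h
    · exact haP h
    · obtain ⟨P', hP', h⟩ := (hPp.prod_mem_iff).1 h
      exact hcP P' (hfin.mem_toFinset.1 hP') h
  have hdI : d ∈ I.radical := by
    refine 𝒢.mem_radical_of_vanishing I d fun z hz => ?_
    by_contra hdz
    have hker : (RingHom.ker (𝒢.evalHom z)).IsPrime := RingHom.ker_isPrime _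
    obtain ⟨P', hP', hle⟩ := Ideal.exists_minimalPrimes_le (I := (⊥ : Ideal 𝒢.coord))
      (J := RingHom.ker (𝒢.evalHom z)) bot_le
    change 𝒢.evalHom z d ≠ 0 at hdz
    rw [map_mul, map_prod] at hdz
    have haz : 𝒢.evalHom z a ≠ 0 := left_ne_zero_of_mul hdz
    have hcz := Finset.prod_ne_zero_iff.1 (right_ne_zero_of_mul hdz) P' (hfin.mem_toFinset.2 hP')
    have hPz := hcP' P' hP' fun h => hcz (hle h)
    obtain ⟨ψ, hψ, hψb⟩ := hext ((𝒢.evalHom z).toRingHom.comp A.val.toRingHom)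
      (fun f hf => hle (hPz f f.2 (Ideal.Quotient.eq_zero_iff_mem.1 hf))) haz
    obtain ⟨y, hy⟩ := 𝒢.eval_surj
      { ψ.comp (Ideal.Quotient.mk P) with
        commutes' := fun r => by
          have := RingHom.congr_fun hψ (algebraMap k A r)
          exact this.trans ((𝒢.evalHom z).commutes r) }
    have hy' : ∀ f : 𝒢.coord, ψ (Ideal.Quotient.mk P f) = (f : G → k) y := hy
    have hyz : y⁻¹ * z ∈ H := hsep y z fun f hf => by
      rw [← hy']
      exact RingHom.congr_fun hψ ⟨f, hf⟩
    -- The translate of `b` by `z⁻¹ * y ∈ H` lies in `I` and takes at `z` the value `b y`.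
    have := hz _ (hI _ (H.inv_mem hyz) b hbI)
    rw [translate_apply, mul_inv_rev, inv_inv, mul_inv_cancel_left] at this
    exact hψb ((hy' b).trans this)
  obtain ⟨n, hn⟩ := hdI
  exact ⟨d ^ n, hn, A.pow_mem hdA n, fun h => hdP (hPp.mem_of_pow_mem n h)⟩

end Points

end AffineAlgGroup

/-- A subspace over an infinite field that lies in none of finitely many subspaces does not lie in
their union. -/
theorem Submodule.exists_mem_forall_notMem {k V ι : Type*} [Field k] [Infinite k] [AddCommGroup V]
    [Module k V] [Finite ι] (E : Submodule k V) (p : ι → Submodule k V) (h : ∀ i, ¬ E ≤ p i) :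
    ∃ b ∈ E, ∀ i, b ∉ p i := by
  by_contra! hcon
  obtain ⟨i, hi⟩ := Subspace.exists_eq_top_of_iUnion_eq_univ (k := k)
    (p := fun i => (p i).comap E.subtype) (Set.eq_univ_of_forall fun b => by
      obtain ⟨i, hi⟩ := hcon b b.2
      exact Set.mem_iUnion.2 ⟨i, hi⟩)
  exact h i fun b hb => (hi ▸ Submodule.mem_top : (⟨b, hb⟩ : E) ∈ (p i).comap E.subtype)

/-! ### Separation of cosets, invariant denominators and semi-invariants -/

namespace AffineAlgGroup

variable {k : Type u} {G : Type v} [Field k] [Group G]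

/-- Matrix coefficients of a rational module are polynomial functions. -/
theorem IsRational.coeff_mem {𝒢 : AffineAlgGroup k G} {M : Type w} [AddCommGroup M] [Module k M]
    {ρ : Representation k G M} (hρ : 𝒢.IsRational ρ) (l : M →ₗ[k] k) (m : M) :
    (fun x => l (ρ x m)) ∈ 𝒢.coord := by
  obtain ⟨n, m', f, h⟩ := hρ m
  have : (fun x => l (ρ x m)) = ∑ i, l (m' i) • (f i : G → k) := by
    funext x
    simp [h, Finset.sum_apply, mul_comm]
  rw [this]
  exact Subalgebra.sum_mem _ fun i _ => Subalgebra.smul_mem _ (f i).2 _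

/-- If `H` is the stabilizer of a vector, then the invariant polynomials separate the cosets of
`H`. -/
theorem inv_mul_mem_of_invariants_eq (𝒢 : AffineAlgGroup k G) (H : Subgroup G)
    {M : Type w} [AddCommGroup M] [Module k M] (ρ : Representation k G M) (hρ : 𝒢.IsRational ρ)
    (m₀ : M) (hm₀ : ∀ x : G, x ∈ H ↔ ρ x m₀ = m₀) (u z : G)
    (h : ∀ f ∈ 𝒢.invariants H, (f : G → k) u = (f : G → k) z) : u⁻¹ * z ∈ H := by
  have huz : ρ u m₀ = ρ z m₀ := by
    rw [← sub_eq_zero, ← Module.forall_dual_apply_eq_zero_iff k]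
    intro l
    rw [map_sub, sub_eq_zero]
    refine h ⟨_, hρ.coeff_mem l m₀⟩ (𝒢.mem_invariants_iff.2 fun x hx y => ?_)
    change l (ρ (y * x) m₀) = l (ρ y m₀)
    rw [map_mul, Module.End.mul_apply, (hm₀ x).1 hx]
  rw [hm₀, map_mul, Module.End.mul_apply, ← huz, ← Module.End.mul_apply, ← map_mul,
    inv_mul_cancel, map_one, Module.End.one_apply]

/-- A function fixed by `z` has equal values at `1` and `z`, so separation applies to this pair. -/
theorem mem_iff_forall_invariants (𝒢 : AffineAlgGroup k G) (H : Subgroup G)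
    (hsep : ∀ u z : G, (∀ f ∈ 𝒢.invariants H, (f : G → k) u = (f : G → k) z) → u⁻¹ * z ∈ H)
    (z : G) : z ∈ H ↔ ∀ f ∈ 𝒢.invariants H, 𝒢.translate z f = f := by
  refine ⟨fun hz f hf => hf z hz, fun h => ?_⟩
  have := hsep 1 z fun f hf => by
    conv_lhs => rw [← h f hf, translate_apply, one_mul]
  simpa using this

/-- A nonzero polynomial function lies outside some minimal prime. -/
theorem exists_minimalPrimes_notMem (𝒢 : AffineAlgGroup k G) {f : 𝒢.coord} (hf : f ≠ 0) :
    ∃ P ∈ minimalPrimes 𝒢.coord, f ∉ P := by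
  have := 𝒢.isReduced_coord
  by_contra! h
  have hmem : f ∈ sInf (minimalPrimes 𝒢.coord) := Ideal.mem_sInf.2 fun {P} hP => h P hP
  rw [minimalPrimes, Ideal.sInf_minimalPrimes] at hmem
  have hnil : f ∈ nilradical 𝒢.coord := hmem
  rw [nilradical_eq_zero] at hnil
  exact hf hnil

/-- A polynomial function outside all minimal primes is not a zero divisor. -/
theorem mem_nonZeroDivisors_of_forall_minimalPrimes (𝒢 : AffineAlgGroup k G) {b : 𝒢.coord}
    (hb : ∀ P ∈ minimalPrimes 𝒢.coord, b ∉ P) : b ∈ nonZeroDivisors 𝒢.coord := by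
  rw [mem_nonZeroDivisors_iff_right]
  intro c hc
  by_contra hc0
  obtain ⟨P, hP, hcP⟩ := 𝒢.exists_minimalPrimes_notMem hc0
  have hPp : P.IsPrime := Ideal.IsMinimalPrime.isPrime hP
  exact (hPp.mem_or_mem (hc ▸ P.zero_mem : c * b ∈ P)).elim hcP (hb P hP)

theorem translateRational_algebraMap (𝒢 : AffineAlgGroup k G) (x : G) (f : 𝒢.coord) :
    𝒢.translateRational x (algebraMap 𝒢.coord 𝒢.RationalFun f) =
      algebraMap 𝒢.coord 𝒢.RationalFun (𝒢.translate x f) :=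
  IsFractionRing.ringEquivOfRingEquiv_algebraMap _ _

section

variable [IsAlgClosed k] (𝒢 : AffineAlgGroup k G) (H : Subgroup G)

/-- An `H`-stable ideal that contains a non zero divisor contains an invariant one. -/
theorem exists_invariant_nonZeroDivisor
    (hsep : ∀ u z : G, (∀ f ∈ 𝒢.invariants H, (f : G → k) u = (f : G → k) z) → u⁻¹ * z ∈ H)
    (I : Ideal 𝒢.coord)
    (hI : ∀ h ∈ H, ∀ f ∈ I, 𝒢.translate h f ∈ I) {d : 𝒢.coord} (hd : d ∈ I)
    (hd0 : d ∈ nonZeroDivisors 𝒢.coord) :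
    ∃ b ∈ I, b ∈ 𝒢.invariants H ∧ b ∈ nonZeroDivisors 𝒢.coord := by
  have := 𝒢.isNoetherianRing_coord
  have : Infinite k := IsAlgClosed.instInfinite
  have hfin : Finite (minimalPrimes 𝒢.coord) :=
    minimalPrimes.finite_of_isNoetherianRing 𝒢.coord
  -- The invariants in `I` form only a `k`-subspace, so subspace avoidance over an infinite field
  -- replaces prime avoidance for ideals.
  let E : Submodule k 𝒢.coord :=
    I.restrictScalars k ⊓ (𝒢.invariantSubalgebra H).toSubmodule
  obtain ⟨b, hb, hbP⟩ := E.exists_mem_forall_notMem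
    (fun P : minimalPrimes 𝒢.coord => (P : Ideal 𝒢.coord).restrictScalars k) (by
      intro P hle
      obtain ⟨f, hfI, hfH, hfP⟩ := 𝒢.exists_invariant_mem_notMem_minimalPrime H hsep I hI P.2
        (fun hle => notMem_nonZeroDivisors_of_mem_mem_minimalPrimes (hle hd) P.2 hd0)
      exact hfP (hle ⟨hfI, hfH⟩))
  exact ⟨b, hb.1, hb.2, 𝒢.mem_nonZeroDivisors_of_forall_minimalPrimes fun P hP h =>
    hbP ⟨P, hP⟩ h⟩

/-- The denominators of an invariant `q` form an `H`-stable ideal `I`. If `b ∈ I` is an invariant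
non zero divisor, then `b * q` is an invariant polynomial, as `k[G]` embeds in its ring of
fractions. -/
theorem rationalInvariants_eq_quotientsOfInvariants
    (hsep : ∀ u z : G, (∀ f ∈ 𝒢.invariants H, (f : G → k) u = (f : G → k) z) → u⁻¹ * z ∈ H) :
    𝒢.rationalInvariants H = 𝒢.quotientsOfInvariants H := by
  ext q
  constructor
  · intro hq
    let I : Ideal 𝒢.coord :=
      { carrier := {d | ∃ a : 𝒢.coord, algebraMap 𝒢.coord 𝒢.RationalFun d * q =
          algebraMap 𝒢.coord 𝒢.RationalFun a}
        zero_mem' := ⟨0, by rw [map_zero, zero_mul]⟩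
        add_mem' := by
          rintro d d' ⟨a, ha⟩ ⟨a', ha'⟩
          exact ⟨a + a', by rw [map_add, map_add, add_mul, ha, ha']⟩
        smul_mem' := by
          rintro c d ⟨a, ha⟩
          exact ⟨c * a, by rw [smul_eq_mul, map_mul, map_mul, mul_assoc, ha]⟩ }
    have hI : ∀ h ∈ H, ∀ f ∈ I, 𝒢.translate h f ∈ I := by
      rintro h hh f ⟨a, ha⟩
      refine ⟨𝒢.translate h a, ?_⟩
      have := congrArg (𝒢.translateRational h) ha
      rwa [map_mul, hq h hh, translateRational_algebraMap, translateRational_algebraMap] at this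
    obtain ⟨a, d, rfl⟩ := IsLocalization.exists_mk'_eq (nonZeroDivisors 𝒢.coord) q
    obtain ⟨b, ⟨c, hc⟩, hbH, hb⟩ := 𝒢.exists_invariant_nonZeroDivisor H hsep I hI (d := d)
      ⟨a, by rw [mul_comm, IsLocalization.mk'_spec]⟩ d.2
    refine ⟨c, fun h hh => ?_, ⟨b, hb⟩, hbH, ?_⟩
    · apply IsFractionRing.injective 𝒢.coord 𝒢.RationalFun
      rw [← translateRational_algebraMap, ← hc, map_mul, translateRational_algebraMap,
        hbH h hh, hq h hh]
    · rw [IsLocalization.eq_mk'_iff_mul_eq, mul_comm]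
      exact hc
  · rintro ⟨a, ha, b, hb, rfl⟩ h hh
    rw [IsLocalization.eq_mk'_iff_mul_eq]
    conv_lhs => rw [← hb h hh, ← translateRational_algebraMap, ← map_mul,
      IsLocalization.mk'_spec, translateRational_algebraMap, ha h hh]

/-- If `χ` is the weight of a nonzero semi-invariant polynomial, then so is `χ⁻¹`. -/
theorem exists_semiinvariant_inv
    (hsep : ∀ u z : G, (∀ f ∈ 𝒢.invariants H, (f : G → k) u = (f : G → k) z) → u⁻¹ * z ∈ H)
    (f : 𝒢.coord) (hf : f ≠ 0) (χ : H → k)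
    (hχ : ∀ (h : H) (y : G), (f : G → k) (y * h) = χ h * (f : G → k) y) :
    ∃ g : 𝒢.coord, (g : G → k) 1 ≠ 0 ∧
      ∀ (h : H) (y : G), χ h * (g : G → k) (y * h) = (g : G → k) y := by
  obtain ⟨P, hP, hfP⟩ := 𝒢.exists_minimalPrimes_notMem hf
  obtain ⟨F, hFI, hFH, hFP⟩ := 𝒢.exists_invariant_mem_notMem_minimalPrime H hsep
    (Ideal.span {f}) (by
      intro h hh g hg
      obtain ⟨c, rfl⟩ := Ideal.mem_span_singleton.1 hg
      refine Ideal.mem_span_singleton.2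
        ⟨χ ⟨h, hh⟩ • 𝒢.translate h c, Subtype.ext <| funext fun y => ?_⟩
      change (f : G → k) (y * h) * (c : G → k) (y * h) =
        (f : G → k) y * (χ ⟨h, hh⟩ * (c : G → k) (y * h))
      rw [hχ ⟨h, hh⟩ y]
      ring) hP
    (fun hle => hfP (hle (Ideal.mem_span_singleton_self f)))
  obtain ⟨c, rfl⟩ := Ideal.mem_span_singleton.1 hFI
  obtain ⟨x, hx⟩ : ∃ x, ((f * c : 𝒢.coord) : G → k) x ≠ 0 := by
    by_contra! h
    exact hFP ((Subtype.ext (funext h) : f * c = 0) ▸ P.zero_mem)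
  rw [mem_invariants_iff] at hFH
  have hFH' : ∀ (h : H) y, (f : G → k) (y * h) * (c : G → k) (y * h) =
      (f : G → k) y * (c : G → k) y := fun h y => hFH h h.2 y
  -- Where `f` vanishes, invariance of `f * c` says nothing about the weight of `c`; the product `f
  -- * c * c` does have weight `χ⁻¹`. Left translation commutes with the right action and moves a
  -- point of nonvanishing to `1`.
  refine ⟨𝒢.leftTranslate x (f * c * c), ?_, fun h y => ?_⟩
  · have hx' : (f : G → k) x * (c : G → k) x ≠ 0 := hx
    change (f : G → k) (x * 1) * (c : G → k) (x * 1) * (c : G → k) (x * 1) ≠ 0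
    rw [mul_one]
    exact mul_ne_zero hx' (right_ne_zero_of_mul hx')
  · change χ h * ((f : G → k) (x * (y * h)) * (c : G → k) (x * (y * h)) *
      (c : G → k) (x * (y * h))) = (f : G → k) (x * y) * (c : G → k) (x * y) * (c : G → k) (x * y)
    rw [← mul_assoc x y, hFH' h]
    have h1 := hFH' h (x * y)
    rw [hχ h] at h1
    linear_combination (c : G → k) (x * y) * h1

end

end AffineAlgGroup

/-! ### Determinants of translated functions -/

/-- Linearly independent functions are separated by suitable points. -/
theorem exists_det_ne_zero_of_linearIndependent {k X : Type*} [Field k] {n : ℕ}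
    (e : Fin n → X → k) (he : LinearIndependent k e) :
    ∃ x : Fin n → X, (Matrix.of fun i j => e j (x i)).det ≠ 0 := by
  let s : Set (Fin n → k) := Set.range fun (y : X) (j : Fin n) => e j y
  have hs : Submodule.span k s = ⊤ := by
    by_contra hne
    obtain ⟨φ, hφ, hφs⟩ := Submodule.exists_le_ker_of_lt_top _ (lt_top_iff_ne_top.2 hne)
    apply hφ
    -- A functional vanishing on all tuples of values is a linear relation among the functions.
    have hsum : ∑ i, φ (fun j => if i = j then 1 else 0) • e i = 0 := by
      funext y
      have h0 : φ (fun j => e j y) = 0 := hφs (Submodule.subset_span ⟨y, rfl⟩)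
      rw [LinearMap.pi_apply_eq_sum_univ φ] at h0
      simpa [Finset.sum_apply, mul_comm] using h0
    have h0 := Fintype.linearIndependent_iff.1 he _ hsum
    refine LinearMap.ext fun w => ?_
    rw [LinearMap.pi_apply_eq_sum_univ φ]
    exact Finset.sum_eq_zero fun i _ => by rw [h0 i, smul_zero]
  obtain ⟨f, hfs, -, hf⟩ := Submodule.exists_fun_fin_finrank_span_eq k s
  have hn : Module.finrank k (Submodule.span k s) = n := by
    rw [hs, finrank_top, Module.finrank_fin_fun]
  choose y hy using hfs
  let x : Fin n → X := fun i => y (Fin.cast hn.symm i)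
  refine ⟨x, ?_⟩
  have hrow : LinearIndependent k (Matrix.of fun i j => e j (x i)).row := by
    have : (Matrix.of fun i j => e j (x i)).row = f ∘ Fin.cast hn.symm := by
      funext i
      exact hy _
    rw [this]
    exact hf.comp _ (Fin.cast_injective _)
  have := Matrix.linearIndependent_rows_iff_isUnit.1 hrow
  exact ((Matrix.isUnit_iff_isUnit_det _).1 this).ne_zero

/-- A finite-dimensional subspace has a basis, which stays linearly independent together with any
vector outside the subspace. -/
theorem Submodule.exists_span_eq_linearIndependent_cons {k V : Type*} [Field k] [AddCommGroup V]
    [Module k V] (K : Submodule k V) [FiniteDimensional k K] {v : V} (hv : v ∉ K) :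
    ∃ (d : ℕ) (e : Fin d → V), span k (Set.range e) = K ∧
      LinearIndependent k (Fin.cons v e : Fin (d + 1) → V) := by
  let b := Module.finBasis k K
  have hspan : span k (Set.range fun j => (b j : V)) = K := by
    have : (Set.range fun j => (b j : V)) = K.subtype '' Set.range b := by
      rw [← Set.range_comp]
      rfl
    rw [this, span_image, b.span_eq, map_top, range_subtype]
  refine ⟨_, fun j => b j, hspan, linearIndependent_finCons.2 ⟨?_, hspan.symm ▸ hv⟩⟩
  exact b.linearIndependent.map' K.subtype K.ker_subtype

namespace AffineAlgGroup

variable {k : Type u} {G : Type v} [Field k] [Group G]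

/-- Finitely many polynomial functions lie in a finite-dimensional subspace that is stable under
right translations. -/
theorem exists_finiteDimensional_stable (𝒢 : AffineAlgGroup k G) {ι : Type*} [Finite ι]
    (v : ι → 𝒢.coord) :
    ∃ E : Submodule k 𝒢.coord, FiniteDimensional k E ∧ (∀ i, v i ∈ E) ∧
      ∀ (x : G), ∀ f ∈ E, 𝒢.translate x f ∈ E := by
  let E : ι → Submodule k 𝒢.coord := fun i =>
    Submodule.span k (Set.range fun x => 𝒢.translate x (v i))
  have hfd : ∀ i, FiniteDimensional k (E i) := by
    intro i
    -- By comultiplication, all translates of `v i` lie in the span of the finitely many `a j`.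
    obtain ⟨n, a, b, hab⟩ := 𝒢.comul (v i) (v i).2
    have hle : E i ≤ Submodule.span k (Set.range a) := by
      rw [Submodule.span_le]
      rintro _ ⟨x, rfl⟩
      have : 𝒢.translate x (v i) = ∑ j, (b j : G → k) x • a j := by
        ext y
        rw [translate_apply, hab, AddSubmonoidClass.coe_finsetSum, Finset.sum_apply]
        exact Finset.sum_congr rfl fun j _ => mul_comm _ _
      simp only [this]
      exact Submodule.sum_mem _ fun j _ =>
        Submodule.smul_mem _ _ (Submodule.subset_span ⟨j, rfl⟩)
    have : FiniteDimensional k (Submodule.span k (Set.range a)) :=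
      FiniteDimensional.span_of_finite k (Set.finite_range a)
    exact Submodule.finiteDimensional_of_le hle
  refine ⟨⨆ i, E i, Submodule.finiteDimensional_iSup E, fun i => ?_, fun x => ?_⟩
  · refine (le_iSup E i) (Submodule.subset_span ⟨1, ?_⟩)
    ext y
    simp [translate_apply]
  · have : (⨆ i, E i) ≤ (⨆ i, E i).comap (𝒢.translate x).toLinearMap := by
      refine iSup_le fun i => ?_
      rw [Submodule.span_le]
      rintro _ ⟨y, rfl⟩
      refine (le_iSup E i) (Submodule.subset_span ⟨x * y, ?_⟩)
      ext z
      simp [translate_apply, mul_assoc]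
    exact this

section Determinant

variable (𝒢 : AffineAlgGroup k G)

/-- The function `y ↦ det (e j (x i * y))`. -/
noncomputable def translateDet {d : ℕ} (e : Fin d → 𝒢.coord) (x : Fin d → G) : 𝒢.coord :=
  (Matrix.of fun i j => 𝒢.leftTranslate (x i) (e j)).det

theorem translateDet_apply {d : ℕ} (e : Fin d → 𝒢.coord) (x : Fin d → G) (y : G) :
    (𝒢.translateDet e x : G → k) y =
      (Matrix.of fun i j => (e j : G → k) (x i * y)).det := by
  rw [← evalHom_apply, translateDet, AlgHom.map_det]
  rfl

/-- If `h` acts on the span of the `e j` by the matrix `C`, it acts on the determinant function by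
`det C`. -/
theorem translateDet_apply_mul {d : ℕ} (e : Fin d → 𝒢.coord) (x : Fin d → G) (h : G)
    (C : Matrix (Fin d) (Fin d) k) (hC : ∀ j, 𝒢.translate h (e j) = ∑ l, C l j • e l) (y : G) :
    (𝒢.translateDet e x : G → k) (y * h) = C.det * (𝒢.translateDet e x : G → k) y := by
  rw [translateDet_apply, translateDet_apply, mul_comm, ← Matrix.det_mul]
  congr 1
  ext i j
  rw [Matrix.of_apply, ← mul_assoc, ← translate_apply, hC, AddSubmonoidClass.coe_finsetSum,
    Finset.sum_apply, Matrix.mul_apply]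
  exact Finset.sum_congr rfl fun l _ => mul_comm _ _

/-- The Laplace expansion, along its first column, of the determinant function of
`w, e 0, …, e (d - 1)`, as a linear map in `w`. -/
noncomputable def laplaceMap {d : ℕ} (e : Fin d → 𝒢.coord) (x : Fin (d + 1) → G) :
    𝒢.coord →ₗ[k] 𝒢.coord :=
  ∑ i : Fin (d + 1), (LinearMap.mulLeft k
    ((-1) ^ (i : ℕ) * 𝒢.translateDet e (x ∘ i.succAbove))).comp (𝒢.leftTranslate (x i)).toLinearMap

theorem laplaceMap_eq_sum {d : ℕ} (e : Fin d → 𝒢.coord) (x : Fin (d + 1) → G) (w : 𝒢.coord) :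
    𝒢.laplaceMap e x w = ∑ i : Fin (d + 1),
      (-1) ^ (i : ℕ) * 𝒢.translateDet e (x ∘ i.succAbove) * 𝒢.leftTranslate (x i) w := by
  rw [laplaceMap, LinearMap.sum_apply]
  rfl

theorem laplaceMap_eq_det {d : ℕ} (e : Fin d → 𝒢.coord) (x : Fin (d + 1) → G) (w : 𝒢.coord) :
    𝒢.laplaceMap e x w = 𝒢.translateDet (Fin.cons w e : Fin (d + 1) → 𝒢.coord) x := by
  rw [laplaceMap_eq_sum, translateDet, Matrix.det_succ_column_zero]
  refine Finset.sum_congr rfl fun i _ => ?_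
  rw [mul_right_comm]
  rfl

/-- The determinant has two equal columns. -/
theorem laplaceMap_apply_self {d : ℕ} (e : Fin d → 𝒢.coord) (x : Fin (d + 1) → G) (j : Fin d) :
    𝒢.laplaceMap e x (e j) = 0 := by
  rw [laplaceMap_eq_det, translateDet]
  exact Matrix.det_zero_of_column_eq (Fin.succ_ne_zero j).symm fun i => rfl

theorem laplaceMap_apply_mul {d : ℕ} (e : Fin d → 𝒢.coord) (x : Fin (d + 1) → G) (h : G)
    (C : Matrix (Fin d) (Fin d) k) (hC : ∀ j, 𝒢.translate h (e j) = ∑ l, C l j • e l)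
    (w : 𝒢.coord) (y : G) :
    (𝒢.laplaceMap e x w : G → k) (y * h) =
      C.det * (𝒢.laplaceMap e x (𝒢.translate h w) : G → k) y := by
  simp only [← evalHom_apply, laplaceMap_eq_sum, map_sum, map_mul, Finset.mul_sum]
  refine Finset.sum_congr rfl fun i _ => ?_
  have h1 : 𝒢.evalHom (y * h) (𝒢.leftTranslate (x i) w) =
      𝒢.evalHom y (𝒢.leftTranslate (x i) (𝒢.translate h w)) := by
    simp only [evalHom_apply, leftTranslate_apply, translate_apply, mul_assoc]
  have h2 := 𝒢.translateDet_apply_mul e (x ∘ i.succAbove) h C hC y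
  rw [← evalHom_apply, ← evalHom_apply] at h2
  rw [h1, h2, map_pow, map_pow, map_neg, map_neg, map_one, map_one]
  ring

end Determinant

/-! ### Equivariant maps to the coordinate algebra -/

/-- Nonzero vectors of a rational `H`-module are detected by `H`-equivariant maps to `k[G]`. -/
theorem exists_equivariant_ne_zero [IsAlgClosed k] (𝒢 : AffineAlgGroup k G) (H : Subgroup G)
    (hH : 𝒢.IsClosedSubgroup H)
    (hsep : ∀ u z : G, (∀ f ∈ 𝒢.invariants H, (f : G → k) u = (f : G → k) z) → u⁻¹ * z ∈ H)
    {V : Type w} [AddCommGroup V] [Module k V] [FiniteDimensional k V] (σ : Representation k H V)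
    (hσ : (𝒢.ofClosed H hH).IsRational σ) (v : V) (hv : v ≠ 0) :
    ∃ T : V →ₗ[k] 𝒢.coord,
      (∀ (h : H) (m : V), T (σ h m) = 𝒢.translate (h : G) (T m)) ∧ T v ≠ 0 := by
  obtain ⟨l, hl⟩ : ∃ l : Module.Dual k V, l v ≠ 0 := by
    by_contra! h
    exact hv ((Module.forall_dual_apply_eq_zero_iff k v).1 h)
  let r : 𝒢.coord →ₗ[k] (H → k) := ((restrictHom k H).comp 𝒢.coord.val).toLinearMap
  let b := Module.finBasis k V
  have hlift : ∀ j, ∃ f : 𝒢.coord, ∀ x : H, (f : G → k) x = l (σ x (b j)) := fun j => by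
    obtain ⟨f, hf, hfj⟩ := Subalgebra.mem_map.1 (hσ.coeff_mem l (b j))
    exact ⟨⟨f, hf⟩, fun x => congrFun hfj x⟩
  choose F hF using hlift
  -- `L` is a linear lift of the coefficient map `V → k[H]`; its equivariance holds only after
  -- restriction to `H`.
  let L : V →ₗ[k] 𝒢.coord := b.constr k F
  have hL : ∀ (m : V) (x : H), (L m : G → k) x = l (σ x m) := by
    intro m x
    have : (𝒢.evalHom (x : G)).toLinearMap.comp L = l.comp (σ x) := b.ext fun j => by
      simpa [L, evalHom_apply] using hF j x
    exact LinearMap.congr_fun this m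
  obtain ⟨E, hE, hFE, hEst⟩ := 𝒢.exists_finiteDimensional_stable F
  have hLE : ∀ m, L m ∈ E := by
    have : LinearMap.range L ≤ E := by
      rw [b.constr_range, Submodule.span_le]
      rintro _ ⟨j, rfl⟩
      exact hFE j
    exact fun m => this ⟨m, rfl⟩
  -- `K` contains every failure of equivariance of `L`, but not `L v`, whose value at `1` is `l v ≠
  -- 0`.
  let K : Submodule k 𝒢.coord := E ⊓ LinearMap.ker r
  have hmemK : ∀ f, f ∈ K ↔ f ∈ E ∧ ∀ x : H, (f : G → k) x = 0 := fun f => by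
    rw [Submodule.mem_inf, LinearMap.mem_ker, funext_iff]
    rfl
  have : FiniteDimensional k K := Submodule.finiteDimensional_inf_left _ _
  have hK : ∀ (h : H), ∀ f ∈ K, 𝒢.translate (h : G) f ∈ K := by
    intro h f hf
    rw [hmemK] at hf ⊢
    exact ⟨hEst _ _ hf.1, fun x => hf.2 (x * h)⟩
  have hLv : L v ∉ K := by
    intro h
    have := ((hmemK _).1 h).2 1
    rw [hL, map_one] at this
    exact hl this
  obtain ⟨d, e, hspan, hind⟩ := K.exists_span_eq_linearIndependent_cons hLv
  have hC : ∀ h : H, ∃ C : Matrix (Fin d) (Fin d) k,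
      ∀ j, 𝒢.translate (h : G) (e j) = ∑ i, C i j • e i := by
    intro h
    have hmem : ∀ j, 𝒢.translate (h : G) (e j) ∈ Submodule.span k (Set.range e) := fun j => by
      rw [hspan]
      exact hK h _ (hspan.le (Submodule.subset_span ⟨j, rfl⟩))
    choose c hc using fun j => (Submodule.mem_span_range_iff_exists_fun k).1 (hmem j)
    exact ⟨Matrix.of fun i j => c j i, fun j => (hc j).symm⟩
  choose C hC using hC
  obtain ⟨x, hx⟩ := exists_det_ne_zero_of_linearIndependent
    (fun j => ((Fin.cons (L v) e : Fin (d + 1) → 𝒢.coord) j : G → k))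
    (hind.map' 𝒢.coord.val.toLinearMap (LinearMap.ker_eq_bot.2 Subtype.val_injective))
  let S := 𝒢.laplaceMap e x
  have hSK : ∀ f ∈ K, S f = 0 := by
    have : K ≤ LinearMap.ker S := by
      rw [← hspan, Submodule.span_le]
      rintro _ ⟨j, rfl⟩
      exact 𝒢.laplaceMap_apply_self e x j
    exact this
  have hS1 : (S (L v) : G → k) 1 ≠ 0 := by
    rw [show S (L v) = _ from 𝒢.laplaceMap_eq_det e x (L v), translateDet_apply]
    simpa using hx
  -- A nonzero minor in the `e j` alone is a semi-invariant of weight `det C`, the character to be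
  -- cancelled.
  obtain ⟨i, hi⟩ : ∃ i : Fin (d + 1), 𝒢.translateDet e (x ∘ i.succAbove) ≠ 0 := by
    by_contra! h
    apply hS1
    rw [show S (L v) = _ from 𝒢.laplaceMap_eq_sum e x (L v)]
    simp [h]
  obtain ⟨g, hg1, hg⟩ := 𝒢.exists_semiinvariant_inv H hsep _ hi (fun h => (C h).det)
    (fun h y => 𝒢.translateDet_apply_mul e _ h (C h) (hC h) y)
  -- Both `g` and `S (L v)` are nonzero at the same point `1`, so their product is nonzero even
  -- though `k[G]` may have zero divisors.
  refine ⟨(LinearMap.mulLeft k g).comp (S.comp L), fun h m => ?_, fun h0 => ?_⟩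
  · have hdiff : S (L (σ h m)) = S (𝒢.translate (h : G) (L m)) := by
      rw [← sub_eq_zero, ← map_sub]
      refine hSK _ ((hmemK _).2 ⟨E.sub_mem (hLE _) (hEst _ _ (hLE _)), fun y => ?_⟩)
      change (L (σ h m) : G → k) y - (L m : G → k) ((y * h : H) : G) = 0
      rw [hL, hL, map_mul, Module.End.mul_apply, sub_self]
    ext y
    change (g : G → k) y * (S (L (σ h m)) : G → k) y =
      (g : G → k) (y * h) * (S (L m) : G → k) (y * h)
    rw [hdiff, 𝒢.laplaceMap_apply_mul e x h (C h) (hC h), ← hg h y]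
    ring
  · exact mul_ne_zero hg1 hS1 (congrFun (congrArg Subtype.val h0) 1)

/-! ### Rational modules and observability -/

/-- A finite-dimensional module with polynomial matrix coefficients is rational. -/
theorem isRational_of_coeff_mem (𝒢 : AffineAlgGroup k G) {N : Type*} [AddCommGroup N] [Module k N]
    [FiniteDimensional k N] (ρ : Representation k G N)
    (h : ∀ (l : N →ₗ[k] k) (m : N), (fun x => l (ρ x m)) ∈ 𝒢.coord) : 𝒢.IsRational ρ := by
  intro m
  let b := Module.finBasis k N
  exact ⟨_, b, fun i => ⟨_, h (b.coord i) m⟩, fun x => (b.sum_repr (ρ x m)).symm⟩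

/-- The direct power of a representation. -/
def powRep (ι : Type*) {W : Type*} [AddCommGroup W] [Module k W] (ρ : Representation k G W) :
    Representation k G (ι → W) where
  toFun x := LinearMap.pi fun i => (ρ x).comp (LinearMap.proj i)
  map_one' := LinearMap.ext fun F => funext fun i => by simp
  map_mul' x y := LinearMap.ext fun F => funext fun i => by simp

theorem IsRational.powRep {𝒢 : AffineAlgGroup k G} (ι : Type*) [Finite ι] {W : Type*}
    [AddCommGroup W] [Module k W] [FiniteDimensional k W] {ρ : Representation k G W}
    (hρ : 𝒢.IsRational ρ) : 𝒢.IsRational (powRep ι ρ) := by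
  classical
  have := Fintype.ofFinite ι
  refine 𝒢.isRational_of_coeff_mem _ fun l F => ?_
  have : (fun x => l (AffineAlgGroup.powRep ι ρ x F)) =
      ∑ i, fun x => (l.comp (LinearMap.single k (fun _ : ι => W) i)) (ρ x (F i)) := by
    funext x
    rw [Finset.sum_apply, ← LinearMap.sum_single_apply (fun _ : ι => W)
      (AffineAlgGroup.powRep ι ρ x F), map_sum]
    rfl
  rw [this]
  exact Subalgebra.sum_mem _ fun i _ => hρ.coeff_mem _ _

/-- The representation of `G` by right translations on a stable subspace of `k[G]`. -/
def translateRep (𝒢 : AffineAlgGroup k G) (E : Submodule k 𝒢.coord)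
    (hE : ∀ (x : G), ∀ f ∈ E, 𝒢.translate x f ∈ E) : Representation k G E where
  toFun x := (𝒢.translate x).toLinearMap.restrict (hE x)
  map_one' := by
    ext F y
    change (F : G → k) (y * 1) = (F : G → k) y
    rw [mul_one]
  map_mul' x y := by
    ext F z
    change (F : G → k) (z * (x * y)) = (F : G → k) (z * x * y)
    rw [mul_assoc]

theorem isRational_translateRep (𝒢 : AffineAlgGroup k G)
    (E : Submodule k 𝒢.coord) [FiniteDimensional k E]
    (hE : ∀ (x : G), ∀ f ∈ E, 𝒢.translate x f ∈ E) :
    𝒢.IsRational (M := E) (𝒢.translateRep E hE) := by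
  refine 𝒢.isRational_of_coeff_mem (N := E) _ fun m f => ?_
  -- The `a j` below need not lie in `E`, so the functional is first extended to `k[G]`.
  obtain ⟨m', hm'⟩ := LinearMap.exists_extend m
  obtain ⟨n, a, b, hab⟩ := 𝒢.comul f f.1.2
  have : (fun x => m (𝒢.translateRep E hE x f)) = ∑ j, m' (a j) • (b j : G → k) := by
    funext x
    have h1 : 𝒢.translate x f = ∑ j, (b j : G → k) x • a j := by
      ext y
      rw [translate_apply, hab, AddSubmonoidClass.coe_finsetSum, Finset.sum_apply]
      exact Finset.sum_congr rfl fun j _ => mul_comm _ _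
    have h2 : E.subtype (𝒢.translateRep E hE x f) = 𝒢.translate x f := rfl
    rw [← hm', LinearMap.comp_apply, h2, h1, map_sum, Finset.sum_apply]
    exact Finset.sum_congr rfl fun j _ => by
      rw [map_smul, smul_eq_mul, mul_comm]
      rfl
  rw [this]
  exact Subalgebra.sum_mem _ fun i _ => Subalgebra.smul_mem _ (b i).2 _

/-- A finite-dimensional rational `G`-module has a copy in the universe of `k`. -/
theorem exists_isRational_equiv (𝒢 : AffineAlgGroup k G) {N : Type*} [AddCommGroup N] [Module k N]
    [FiniteDimensional k N] (ρ : Representation k G N) (hρ : 𝒢.IsRational ρ) :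
    ∃ (n : ℕ) (ρ' : Representation k G (Fin n → k)) (e : N ≃ₗ[k] (Fin n → k)),
      𝒢.IsRational ρ' ∧ ∀ x m, e (ρ x m) = ρ' x (e m) := by
  let e := (Module.finBasis k N).equivFun
  let ρ' : Representation k G (Fin (Module.finrank k N) → k) :=
    { toFun := fun x => e.toLinearMap ∘ₗ ρ x ∘ₗ e.symm.toLinearMap
      map_one' := by ext; simp
      map_mul' := fun x y => by ext; simp }
  refine ⟨_, ρ', e, 𝒢.isRational_of_coeff_mem _ fun l m => ?_, fun x m => ?_⟩
  · exact hρ.coeff_mem (l ∘ₗ e.toLinearMap) (e.symm m)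
  · simp [ρ']

/-- A minimal finite intersection of kernels of equivariant maps `V → k[G]` is zero, since a nonzero
vector in it could be detected by one more map. The maps land in one finite-dimensional stable `E`,
so `V` embeds in a power of `E`. -/
theorem isObservable_of_invariants_separate [IsAlgClosed k] (𝒢 : AffineAlgGroup k G)
    (H : Subgroup G) (hH : 𝒢.IsClosedSubgroup H)
    (hsep : ∀ u z : G, (∀ f ∈ 𝒢.invariants H, (f : G → k) u = (f : G → k) z) → u⁻¹ * z ∈ H) :
    𝒢.IsObservable H hH := by
  intro V _ _ _ σ hσ
  let Eqv : Set (V →ₗ[k] 𝒢.coord) :=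
    {T | ∀ (h : H) (m : V), T (σ h m) = 𝒢.translate (h : G) (T m)}
  let 𝒦 : Set (Submodule k V) :=
    {K | ∃ (n : ℕ) (T : Fin n → V →ₗ[k] 𝒢.coord), (∀ i, T i ∈ Eqv) ∧ K = ⨅ i, LinearMap.ker (T i)}
  obtain ⟨K, ⟨n, T, hT, hK⟩, hmin⟩ := IsArtinian.set_has_minimal 𝒦
    ⟨_, 0, Fin.elim0, fun i => i.elim0, rfl⟩
  have hbot : K = ⊥ := by
    by_contra hne
    obtain ⟨v, hvK, hv⟩ := (Submodule.ne_bot_iff _).1 hne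
    obtain ⟨T', hT', hTv⟩ := 𝒢.exists_equivariant_ne_zero H hH hsep σ hσ v hv
    refine hmin (LinearMap.ker T' ⊓ K) ⟨n + 1, Fin.cons T' T, Fin.cases hT' hT, ?_⟩ ?_
    · rw [hK]
      ext m
      simp [Submodule.mem_iInf, Fin.forall_fin_succ]
    · exact lt_of_le_of_ne inf_le_right fun h => hTv (h.ge hvK).1
  let b := Module.finBasis k V
  obtain ⟨E, hEfd, hTE, hE⟩ := 𝒢.exists_finiteDimensional_stable
    fun p : Fin n × Fin (Module.finrank k V) => T p.1 (b p.2)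
  have hTE' : ∀ i m, T i m ∈ E := fun i m => by
    rw [← b.sum_repr m, map_sum]
    exact E.sum_mem fun j _ => by
      rw [map_smul]
      exact E.smul_mem _ (hTE (i, j))
  obtain ⟨d, ρ', e, hρ', he⟩ :=
    𝒢.exists_isRational_equiv (N := E) _ (𝒢.isRational_translateRep E hE)
  let ι : V →ₗ[k] (Fin n → Fin d → k) :=
    LinearMap.pi fun i => e.toLinearMap.comp ((T i).codRestrict E (hTE' i))
  refine ⟨Fin n → Fin d → k, inferInstance, inferInstance, inferInstance, powRep (Fin n) ρ', ι,
    hρ'.powRep (Fin n), ?_, fun x m => ?_⟩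
  · refine (injective_iff_map_eq_zero ι).2 fun m hm => ?_
    have : m ∈ K := by
      rw [hK, Submodule.mem_iInf]
      exact fun i => congrArg Subtype.val (e.map_eq_zero_iff.1 (congrFun hm i))
    rwa [hbot] at this
  · funext i
    refine Eq.trans (congrArg e ?_) (he x ((T i).codRestrict E (hTE' i) m))
    exact Subtype.ext (hT i x m)

end AffineAlgGroup

theorem theorem3p7 {k : Type u} [Field k] [IsAlgClosed k] {G : Type v} [Group G]
    (𝒢 : AffineAlgGroup k G) (H : Subgroup G) (hH : 𝒢.IsClosedSubgroup H)
    {M : Type w} [AddCommGroup M] [Module k M] [FiniteDimensional k M]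
    (ρ : Representation k G M) (hρ : 𝒢.IsRational ρ)
    (m₀ : M) (hm₀ : ∀ x : G, x ∈ H ↔ ρ x m₀ = m₀) :
    𝒢.IsObservable H hH ∧
      (∀ z : G, z ∈ H ↔ ∀ f ∈ 𝒢.invariants H, 𝒢.translate z f = f) ∧
      𝒢.rationalInvariants H = 𝒢.quotientsOfInvariants H := by
  have hsep := 𝒢.inv_mul_mem_of_invariants_eq H ρ hρ m₀ hm₀
  exact ⟨𝒢.isObservable_of_invariants_separate H hH hsep, 𝒢.mem_iff_forall_invariants H hsep,
    𝒢.rationalInvariants_eq_quotientsOfInvariants H hsep⟩
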